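/- Let $\mathcal S$ be a finite or countable set and let $p=(p_{jk})_{j,k\in\mathcal S}$ be an irreducible and recurrent transition matrix with stationary measure $(m_j)_{j\in\mathcal S}$, where $0<m_j<\infty$ and $\sum_k m_kp_{kj}=m_j$ for all $j$. For $i\in\mathcal S$ let $\mathbb P_i$ be the law on $\mathcal S^{\mathbb Z}$ of the two-sided chain $X=(X_n)_{n\in\mathbb Z}$ with $X_0=i$, that is, $(X_n)_{n\ge0}$ and $(X_{-n})_{n\ge0}$ are independent Markov chains started in $i$ with transition matrices $p$ and $p^*_{jk}=(m_k/m_j)p_{kj}$, respectively; for a probability measure $\nu=(\nu_j)_{j\in\mathcal S}$ put $\mathbb P_\nu=\sum_j\nu_j\mathbb P_j$. Let $L^j(A)=\frac1{m_j}\#\{n\in A:X_n=j\}$ for $A\subset\mathbb Z$. Fix $i\in\mathcal S$ and a probability measure $\nu$ on $\mathcal S$ such that $\nu_i=0$ and $\frac{m_i}{m_j}\nu_j\in\mathbb Z$ for all $j\in\mathcal S$, and let $$T_*=\min\Big\{n\ge0:\ L^i([0,n])\le\sum_{j\in\mathcal S}\nu_j\,L^j([0,n])\Big\}.$$ Then $T_*<\infty$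 holds $\mathbb P_i$-almost surely, and the following is true. Let $(\mathbb Q_\omega)_{\omega\in\mathcal S^{\mathbb Z}}$ be a measurable family of probability measures on a measurable space $\Omega'$, let $\mathbb P_i^{\oplus}(d\omega\,d\omega')=\mathbb P_i(d\omega)\,\mathbb Q_\omega(d\omega')$ with expectation $\mathbb E_i^\oplus$, and let $T\colon\mathcal S^{\mathbb Z}\times\Omega'\to\{0,1,2,\dots\}$ be measurable and such that under $\mathbb P_i^\oplus$ the shifted process $(X_{n+T})_{n\in\mathbb Z}$ has law $\mathbb P_\nu$ (i.e. $T$ is a non-negative, possibly randomized, solution of the embedding problem). Then, for every concave function $\psi\colon\{0,1,2,\dots\}\to[0,\infty)$, $$\mathbb E_i[\psi(T_*)]\ \le\ \mathbb E_i^{\oplus}[\psi(T)],$$ where both sides take values in $[0,\infty]$. -/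

import Mathlib

open MeasureTheory ProbabilityTheory
open scoped ENNReal NNReal

namespace TwoSidedChain

noncomputable section

variable {S : Type*}

/-- The weights `m` are positive, finite and stationary for the transition matrix `p`
(row `i` of the matrix is the probability vector `p i`). -/
structure IsStationary (p : S → PMF S) (m : S → ℝ≥0) : Prop where
  pos : ∀ j, 0 < m j
  stationary : ∀ j, ∑' k, (m k : ℝ≥0∞) * p k j = m j

/-- The dual transition matrix `p*_{ij} = (m_j / m_i) p_{ji}`. -/
def dual (p : S → PMF S) (m : S → ℝ≥0) (hm : IsStationary p m) (i : S) : PMF S :=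
  ⟨fun j => (m j : ℝ≥0∞) / m i * p j i, by
    have h0 : (m i : ℝ≥0∞) ≠ 0 := by exact_mod_cast (hm.pos i).ne'
    have h : ∑' j, (m j : ℝ≥0∞) / m i * p j i = 1 := by
      have e : ∀ j, (m j : ℝ≥0∞) / m i * p j i = (m i : ℝ≥0∞)⁻¹ * (m j * p j i) := by
        intro j
        rw [div_eq_mul_inv]
        ring
      simp_rw [e]
      rw [ENNReal.tsum_mul_left, hm.stationary i,
        ENNReal.inv_mul_cancel h0 ENNReal.coe_ne_top]
    exact h ▸ ENNReal.summable.hasSum⟩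

/-- A forward and a backward trajectory, glued to a trajectory indexed by `ℤ`. -/
def glue (x : (ℕ → S) × (ℕ → S)) (n : ℤ) : S :=
  if 0 ≤ n then x.1 n.toNat else x.2 (-n).toNat

variable [MeasurableSpace S]

lemma measurable_glue : Measurable (glue : (ℕ → S) × (ℕ → S) → ℤ → S) := by
  refine measurable_pi_iff.2 fun n => ?_
  unfold glue
  split_ifs <;> fun_prop

variable [DiscreteMeasurableSpace S]

/-- The Markov kernel given by a transition matrix. -/
def stepKernel (p : S → PMF S) : Kernel S S := ⟨fun i => (p i).toMeasure, Measurable.of_discrete⟩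

instance (p : S → PMF S) : IsMarkovKernel (stepKernel p) :=
  ⟨fun i => PMF.toMeasure.isProbabilityMeasure (p i)⟩

/-- The law of the one-sided chain `(X_n : n ≥ 0)` with transition matrix `p` and `X_0 = i`. -/
def chainLaw (p : S → PMF S) (i : S) : Measure (ℕ → S) :=
  Kernel.traj (X := fun _ => S)
    (fun n => (stepKernel p).comap (fun x => x ⟨n, Finset.mem_Iic.2 le_rfl⟩) (measurable_pi_apply _))
    0 (fun _ => i)

instance (p : S → PMF S) (i : S) : IsProbabilityMeasure (chainLaw p i) := by
  unfold chainLaw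
  infer_instance

/-- Every state can be reached from every other one with positive probability. -/
def IsIrreducible (p : S → PMF S) : Prop :=
  ∀ i j, ∃ n : ℕ, 0 < chainLaw p i {x | x n = j}

/-- From every state, the chain returns to that state almost surely. -/
def IsRecurrent (p : S → PMF S) : Prop :=
  ∀ i, ∀ᵐ x ∂(chainLaw p i), ∃ n : ℕ, 0 < n ∧ x n = i

/-- The law `P_i` of the two-sided chain with transition matrix `p` and `X_0 = i`: given `X_0 = i`,
the forward chain `(X_n)` and the backward chain `(X_{-n})` are independent, with transition
matrices `p` and `p*`. -/
def twoSidedLaw (p : S → PMF S) (m : S → ℝ≥0) (hm : IsStationary p m) (i : S) :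
    Measure (ℤ → S) :=
  ((chainLaw p i).prod (chainLaw (dual p m hm) i)).map glue

instance (p : S → PMF S) (m : S → ℝ≥0) (hm : IsStationary p m) (i : S) :
    IsProbabilityMeasure (twoSidedLaw p m hm i) :=
  Measure.isProbabilityMeasure_map measurable_glue.aemeasurable

/-- The law `P_ν = ∑ ν_j P_j` of the two-sided chain with initial distribution `ν`. -/
def twoSidedLawOf (p : S → PMF S) (m : S → ℝ≥0) (hm : IsStationary p m) (ν : PMF S) :
    Measure (ℤ → S) :=
  Measure.sum fun j => ν j • twoSidedLaw p m hm j

/-- The law `P_i^⊕` of the two-sided chain started in `i` together with extra randomness, which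
given the trajectory `ω` has law `Q ω`. -/
def extendedLaw (p : S → PMF S) (m : S → ℝ≥0) (hm : IsStationary p m) (i : S)
    {Ω : Type*} [MeasurableSpace Ω] (Q : Kernel (ℤ → S) Ω) : Measure ((ℤ → S) × Ω) :=
  (twoSidedLaw p m hm i) ⊗ₘ Q

/-- The (possibly randomized) random time `T` solves the embedding problem for the chain started
in `i` and the target `ν`: `(X_{n+T} : n ∈ ℤ)` is the two-sided chain with initial
distribution `ν`. -/
structure IsEmbedding (p : S → PMF S) (m : S → ℝ≥0) (hm : IsStationary p m) (i : S) (ν : PMF S)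
    {Ω : Type*} [MeasurableSpace Ω] (Q : Kernel (ℤ → S) Ω) (T : (ℤ → S) × Ω → ℤ) : Prop where
  measurable : Measurable T
  law : (extendedLaw p m hm i Q).map (fun z n => z.1 (n + T z)) = twoSidedLawOf p m hm ν

/-- The local time `L^j(A) = #{n ∈ A : X_n = j} / m_j`. -/
def localTime (m : S → ℝ≥0) (ω : ℤ → S) (j : S) (A : Set ℤ) : ℝ≥0∞ :=
  ((A ∩ {n | ω n = j}).encard : ℝ≥0∞) / m j

/-- The time `T_* = min {n ≥ 0 : L^i([0,n]) ≤ ∑_j ν_j L^j([0,n])}`, with value `⊤` if there is no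
such `n`. -/
def Tstar (m : S → ℝ≥0) (i : S) (ν : PMF S) (ω : ℤ → S) : ℕ∞ :=
  sInf ((fun n : ℕ => (n : ℕ∞)) '' {n : ℕ |
    localTime m ω i (Set.Icc 0 (n : ℤ)) ≤ ∑' j, ν j * localTime m ω j (Set.Icc 0 (n : ℤ))})

end

/-- Concavity of a function on the non-negative integers: the increments are non-increasing. -/
def IsConcave (ψ : ℕ → ℝ) : Prop := ∀ n, ψ (n + 2) - ψ (n + 1) ≤ ψ (n + 1) - ψ n

end TwoSidedChain

/-!
Give a state `j` the weights `a j = 1` if `j = i` and `0` otherwise, and `b j = m_i ν_j / m_j`.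
Both are integer valued, and `T_* > r` says that along the path the running sums of `a` are
strictly ahead of those of `b` at all times `0, …, r`. Let `μ = ∑ m_j P_j`, which is
shift-invariant.

Fix `k`, and mark the times `l < k` such that the path restarted at `l` stays ahead up to time
`k - 1`. From each marked time to the next one, and from the last one to the end, `a` gains at least
`1` over `b`. So the number of marked times is at most the gain of `a` over `b` since the first of
them. Taking expectations, `∑_{r<k} μ(T_* > r) ≤ ∑_{n<k} (∫_{E_n} a dμ - ∫_{E_n} b dμ)`, where `E_n`
is the event, seen with time `n` as the present, that some time up to `n` was marked. An embedding
`T` transports `a μ = m_i P_i` to `b μ = m_i P_ν`, and a path that is in `E_n` is still in `E_{n+t}`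
after `t` shifts; hence `T` loses at most `min(k, T)` of the times counted on the right. This gives
`∑_{r<k} P_i(T_* > r) ≤ ∑_{r<k} P_i^⊕(T > r)` for all `k`, which is the claim for all concave `ψ` by
summation by parts.

For `T_* < ∞`, let `A` be the event of staying ahead forever. The same inequality for the times at
which the path is in `A` yields `k μ(A) + ∑_{n<k} ∫_{F_n} b dμ ≤ k ∫_F a dμ`, with `F_n` increasing
to the event `F` that `A` has occurred at some time up to now. The shift is conservative by
recurrence, so `F` agrees up to a null set with a shift-invariant event of the future, which has the
same probability under all `P_j`; therefore `∫_F a dμ = ∫_F b dμ < ∞`, and dividing by `k` gives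
`μ(A) = 0`.
-/

namespace TwoSidedChain

open Set Function Filter Topology

section Concave

theorem IsConcave.antitone_increment {ψ : ℕ → ℝ} (hψ : IsConcave ψ) :
    Antitone fun n => ψ (n + 1) - ψ n :=
  antitone_nat_of_succ_le hψ

theorem IsConcave.monotone_of_nonneg {ψ : ℕ → ℝ} (hψ : IsConcave ψ) (h0 : ∀ n, 0 ≤ ψ n) :
    Monotone ψ := by
  refine monotone_nat_of_le_succ fun n => ?_
  by_contra! hn
  have hlin (k : ℕ) : ψ (n + k) ≤ ψ n + k * (ψ (n + 1) - ψ n) := by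
    induction k with
    | zero => simp
    | succ k ih =>
      have hinc : ψ (n + k + 1) - ψ (n + k) ≤ ψ (n + 1) - ψ n :=
        hψ.antitone_increment (Nat.le_add_right n k)
      push_cast [← add_assoc]
      linarith
  obtain ⟨k, hk⟩ := exists_nat_gt (ψ n / (ψ n - ψ (n + 1)))
  rw [div_lt_iff₀ (by linarith)] at hk
  linarith [hlin k, h0 (n + k)]

/-- Summation by parts, arranged so that every subtraction is of a smaller term. -/
theorem sum_range_mul_of_antitone {a : ℕ → ℝ≥0∞} (ha : Antitone a) (u : ℕ → ℝ≥0∞) (N : ℕ) :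
    ∑ r ∈ Finset.range N, a r * u r =
      a N * ∑ r ∈ Finset.range N, u r +
        ∑ k ∈ Finset.range N, (a k - a (k + 1)) * ∑ r ∈ Finset.range (k + 1), u r := by
  induction N with
  | zero => simp
  | succ N ih =>
    have hN : a N = a (N + 1) + (a N - a (N + 1)) :=
      (add_tsub_cancel_of_le (ha N.le_succ)).symm
    calc ∑ r ∈ Finset.range (N + 1), a r * u r
      _ = a N * ∑ r ∈ Finset.range (N + 1), u r +
          ∑ k ∈ Finset.range N, (a k - a (k + 1)) * ∑ r ∈ Finset.range (k + 1), u r := by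
        rw [Finset.sum_range_succ, ih, Finset.sum_range_succ u]
        ring
      _ = _ := by
        rw [Finset.sum_range_succ (fun k => (a k - a (k + 1)) * _) N]
        nth_rw 1 [hN]
        ring

theorem tsum_mul_le_tsum_mul_of_antitone {a u v : ℕ → ℝ≥0∞} (ha : Antitone a)
    (huv : ∀ k, ∑ r ∈ Finset.range k, u r ≤ ∑ r ∈ Finset.range k, v r) :
    ∑' r, a r * u r ≤ ∑' r, a r * v r := by
  simp_rw [ENNReal.tsum_eq_iSup_nat]
  refine iSup_mono fun N => ?_
  rw [sum_range_mul_of_antitone ha, sum_range_mul_of_antitone ha]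
  exact add_le_add (mul_le_mul_right (huv N) _)
    (Finset.sum_le_sum fun k _ => mul_le_mul_right (huv (k + 1)) _)

theorem add_sum_range_tsub_of_monotone {φ : ℕ → ℝ≥0∞} (hφ : Monotone φ) (n : ℕ) :
    φ 0 + ∑ r ∈ Finset.range n, (φ (r + 1) - φ r) = φ n := by
  induction n with
  | zero => simp
  | succ n ih => rw [Finset.sum_range_succ, ← add_assoc, ih, add_tsub_cancel_of_le (hφ n.le_succ)]

theorem lintegral_comp_nat_of_monotone {α : Type*} [MeasurableSpace α] (μ : Measure α)
    {U : α → ℕ} (hU : Measurable U) {φ : ℕ → ℝ≥0∞} (hφ : Monotone φ) :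
    ∫⁻ x, φ (U x) ∂μ = φ 0 * μ univ + ∑' r, (φ (r + 1) - φ r) * μ {x | r < U x} := by
  have hmeas (r : ℕ) : MeasurableSet {x | r < U x} := hU (measurableSet_Ioi (a := r))
  have hφU (x : α) :
      φ (U x) = φ 0 + ∑' r, {x | r < U x}.indicator (fun _ => φ (r + 1) - φ r) x := by
    have htail : ∀ r ∉ Finset.range (U x),
        {x | r < U x}.indicator (fun _ => φ (r + 1) - φ r) x = 0 := fun r hr =>
      indicator_of_notMem (by simpa using hr) _
    rw [tsum_eq_sum htail, Finset.sum_congr rfl fun r hr =>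
      indicator_of_mem (show x ∈ {x | r < U x} from Finset.mem_range.1 hr) _,
      add_sum_range_tsub_of_monotone hφ]
  simp_rw [hφU]
  rw [lintegral_add_left measurable_const, lintegral_const,
    lintegral_tsum fun r => (measurable_const.indicator (hmeas r)).aemeasurable]
  simp_rw [lintegral_indicator_const (hmeas _)]

theorem lintegral_ofReal_concave_le {α β : Type*} [MeasurableSpace α] [MeasurableSpace β]
    {μ : Measure α} {P : Measure β} (huniv : μ univ ≤ P univ)
    {U : α → ℕ} (hU : Measurable U) {T : β → ℕ} (hT : Measurable T)
    (hUT : ∀ k, ∑ r ∈ Finset.range k, μ {x | r < U x} ≤ ∑ r ∈ Finset.range k, P {z | r < T z})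
    {ψ : ℕ → ℝ} (hψ : IsConcave ψ) (h0 : ∀ n, 0 ≤ ψ n) :
    ∫⁻ x, ENNReal.ofReal (ψ (U x)) ∂μ ≤ ∫⁻ z, ENNReal.ofReal (ψ (T z)) ∂P := by
  have hmono : Monotone fun n => ENNReal.ofReal (ψ n) := fun _ _ h =>
    ENNReal.ofReal_le_ofReal (hψ.monotone_of_nonneg h0 h)
  have hanti : Antitone fun r => ENNReal.ofReal (ψ (r + 1)) - ENNReal.ofReal (ψ r) := by
    simp_rw [← ENNReal.ofReal_sub _ (h0 _)]
    exact fun _ _ h => ENNReal.ofReal_le_ofReal (hψ.antitone_increment h)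
  rw [lintegral_comp_nat_of_monotone μ hU hmono, lintegral_comp_nat_of_monotone P hT hmono]
  exact add_le_add (mul_le_mul_right huniv _) (tsum_mul_le_tsum_mul_of_antitone hanti hUT)

end Concave

theorem iterate_sub_apply_iterate {α : Type*} {g f : α → α} (h : LeftInverse g f) {l n : ℕ}
    (hl : l ≤ n) (x : α) : g^[n - l] (f^[n] x) = f^[l] x := by
  obtain ⟨j, rfl⟩ := Nat.exists_eq_add_of_le hl
  rw [Nat.add_sub_cancel_left, Nat.add_comm l j, iterate_add_apply]
  exact (h.iterate j) _

section Ahead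

variable {α : Type*}

/-- The points along whose `f`-orbit the running sums of `u` are strictly ahead of those of `v` at
each of the times `0, …, r`, the sum at time `n` including the term of index `n`. -/
def aheadUntil (f : α → α) (u v : α → ℕ) (r : ℕ) : Set α :=
  {x | ∀ n ≤ r, birkhoffSum f v (n + 1) x < birkhoffSum f u (n + 1) x}

/-- The points that, if the present is time `n`, were in the set `B l` at some time `l ∈ [0, n]`.
They are described through the backward orbit, so that one set serves for all orbits. -/
def entered (f : α ≃ α) (B : ℕ → Set α) (n : ℕ) : Set α :=
  {x | ∃ l ≤ n, f.symm^[n - l] x ∈ B l}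

variable {f : α ≃ α} {u v : α → ℕ} {B : ℕ → Set α}

theorem iterate_mem_entered_iff {n : ℕ} {x : α} :
    f^[n] x ∈ entered f B n ↔ ∃ l ≤ n, f^[l] x ∈ B l := by
  refine exists_congr fun l => and_congr_right fun hl => ?_
  rw [iterate_sub_apply_iterate f.symm_apply_apply hl]

theorem apply_mem_entered {n : ℕ} {x : α} (hx : x ∈ entered f B n) :
    f x ∈ entered f B (n + 1) := by
  obtain ⟨l, hl, hxl⟩ := hx
  refine ⟨l, hl.trans n.le_succ, ?_⟩
  rwa [Nat.succ_sub hl, iterate_succ_apply, f.symm_apply_apply]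

theorem mem_entered_const {A : Set α} {n : ℕ} {x : α} :
    x ∈ entered f (fun _ => A) n ↔ ∃ l ≤ n, f.symm^[l] x ∈ A := by
  constructor
  · rintro ⟨l, -, hl⟩
    exact ⟨n - l, Nat.sub_le n l, hl⟩
  · rintro ⟨l, hln, hl⟩
    exact ⟨n - l, Nat.sub_le n l, by rwa [Nat.sub_sub_self hln]⟩

open Classical in
theorem sum_ite_add_sum_ite_le {u v : ℕ → ℕ} {p : ℕ → Prop} {k : ℕ}
    (h : ∀ l, p l → ∀ n, l < n → n ≤ k → ∑ j ∈ Finset.Ico l n, v j < ∑ j ∈ Finset.Ico l n, u j) :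
    (∑ l ∈ Finset.range k, if p l then 1 else 0) +
        (∑ n ∈ Finset.range k, if ∃ l ≤ n, p l then v n else 0) ≤
      ∑ n ∈ Finset.range k, if ∃ l ≤ n, p l then u n else 0 := by
  -- Between two consecutive times satisfying `p`, and after the last one, `u` gains at least `1`.
  suffices ∀ n ≤ k, (∑ l ∈ Finset.range n, if p l then 1 else 0) +
        (∑ j ∈ Finset.range n, if ∃ l ≤ j, p l then v j else 0) ≤
      ∑ j ∈ Finset.range n, if ∃ l ≤ j, p l then u j else 0 from this k le_rfl
  intro n
  induction n using Nat.strong_induction_on with | _ n ih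
  intro hnk
  by_cases hp : ∃ l < n, p l
  · obtain ⟨l, ⟨hln, hpl⟩, hlast⟩ : ∃ l, (l < n ∧ p l) ∧ ∀ j, l < j → j < n → ¬p j := by
      obtain ⟨l₀, hl₀, hpl₀⟩ := hp
      have hn := Nat.findGreatest_spec (P := fun l => l < n ∧ p l) hl₀.le ⟨hl₀, hpl₀⟩
      exact ⟨_, hn, fun j hj hjn hpj =>
        Nat.findGreatest_is_greatest hj hjn.le ⟨hjn, hpj⟩⟩
    have hstarted (w : ℕ → ℕ) : ∑ j ∈ Finset.range n, (if ∃ l ≤ j, p l then w j else 0) =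
        (∑ j ∈ Finset.range l, if ∃ l ≤ j, p l then w j else 0) + ∑ j ∈ Finset.Ico l n, w j := by
      rw [← Finset.sum_range_add_sum_Ico _ hln.le]
      congr 1
      exact Finset.sum_congr rfl fun j hj => if_pos ⟨l, (Finset.mem_Ico.1 hj).1, hpl⟩
    have hcount : ∑ j ∈ Finset.range n, (if p j then 1 else 0) =
        (∑ j ∈ Finset.range l, if p j then 1 else 0) + 1 := by
      rw [← Finset.sum_range_add_sum_Ico _ hln.le, Finset.sum_eq_sum_Ico_succ_bot hln, if_pos hpl,
        Finset.sum_eq_zero fun j hj => if_neg (hlast j (Finset.mem_Ico.1 hj).1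
          (Finset.mem_Ico.1 hj).2), add_zero]
    rw [hstarted u, hstarted v, hcount]
    have hgain := h l hpl n hln hnk
    have hprev := ih l hln (hln.le.trans hnk)
    omega
  · push Not at hp
    rw [Finset.sum_eq_zero fun l hl => if_neg (hp l (Finset.mem_range.1 hl)),
      Finset.sum_eq_zero fun j hj => if_neg fun ⟨l, hlj, hpl⟩ =>
        hp l (hlj.trans_lt (Finset.mem_range.1 hj)) hpl, add_zero]
    exact Nat.zero_le _

theorem sum_Ico_comp_iterate (f : α → α) (w : α → ℕ) (x : α) (l n : ℕ) :
    ∑ j ∈ Finset.Ico l n, w (f^[j] x) = birkhoffSum f w (n - l) (f^[l] x) := by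
  rw [Finset.sum_Ico_eq_sum_range, birkhoffSum]
  refine Finset.sum_congr rfl fun j _ => ?_
  rw [Nat.add_comm l j, iterate_add_apply]

open Classical in
theorem sum_ite_iterate_le {k : ℕ} (hB : ∀ l < k, B l ⊆ aheadUntil f u v (k - 1 - l)) (x : α) :
    (∑ l ∈ Finset.range k, if f^[l] x ∈ B l then 1 else 0) +
        (∑ n ∈ Finset.range k, if f^[n] x ∈ entered f B n then v (f^[n] x) else 0) ≤
      ∑ n ∈ Finset.range k, if f^[n] x ∈ entered f B n then u (f^[n] x) else 0 := by
  simp only [iterate_mem_entered_iff]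
  refine sum_ite_add_sum_ite_le (u := fun n => u (f^[n] x)) (v := fun n => v (f^[n] x))
    (p := fun l => f^[l] x ∈ B l) fun l hl n hln hnk => ?_
  rw [sum_Ico_comp_iterate, sum_Ico_comp_iterate]
  have hlead := hB l (hln.trans_le hnk) hl (n - l - 1) (by omega)
  rwa [Nat.sub_add_cancel (by omega)] at hlead

end Ahead

section Transport

variable {α Z : Type*} [MeasurableSpace α] [MeasurableSpace Z]

open Classical in
theorem sum_ite_le_of_shift {a b : ℕ → Prop} {t : ℕ} (hab : ∀ l, a l → b (l + t)) (k : ℕ) :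
    (∑ l ∈ Finset.range k, if a l then 1 else 0) ≤
      (∑ r ∈ Finset.range k, if r < t then 1 else 0) +
        ∑ n ∈ Finset.range k, if b n then 1 else 0 := by
  simp only [← Finset.card_filter]
  have hsplit : (Finset.range k).filter a ⊆
      Finset.Ico (k - t) k ∪ (Finset.range (k - t)).filter a := by
    intro l hl
    simp only [Finset.mem_filter, Finset.mem_union, Finset.mem_Ico, Finset.mem_range] at hl ⊢
    by_cases hlt : l < k - t
    · exact Or.inr ⟨hlt, hl.2⟩
    · exact Or.inl ⟨not_lt.1 hlt, hl.1⟩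
  have hlate : (Finset.Ico (k - t) k).card = ((Finset.range k).filter (· < t)).card := by
    have hmin : (Finset.range k).filter (· < t) = Finset.range (min k t) := by
      ext r
      simp only [Finset.mem_filter, Finset.mem_range, lt_min_iff]
    rw [hmin, Nat.card_Ico, Finset.card_range]
    omega
  have hshift : ((Finset.range (k - t)).filter a).card ≤ ((Finset.range k).filter b).card := by
    refine Finset.card_le_card_of_injOn (· + t) (fun l hl => ?_) (add_left_injective t).injOn
    simp only [Finset.coe_filter, Finset.mem_range, mem_ofPred_eq] at hl ⊢
    exact ⟨by omega, hab l hl.2⟩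
  calc ((Finset.range k).filter a).card
    _ ≤ (Finset.Ico (k - t) k).card + ((Finset.range (k - t)).filter a).card :=
      (Finset.card_le_card hsplit).trans (Finset.card_union_le _ _)
    _ ≤ _ := by rw [hlate]; exact Nat.add_le_add_left hshift _

theorem measurable_iterate_comp {f : α → α} (hf : Measurable f) {X : Z → α} (hX : Measurable X)
    {T : Z → ℕ} (hT : Measurable T) : Measurable fun z => f^[T z] (X z) :=
  (measurable_from_prod_countable_right (f := fun q : ℕ × α => f^[q.1] q.2)
    fun n => hf.iterate n).comp (hT.prodMk hX)

theorem sum_map_le_of_apply_mem {f : α → α} (hf : Measurable f) {P : Measure Z} {X : Z → α}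
    (hX : Measurable X) {T : Z → ℕ} (hT : Measurable T) {F : ℕ → Set α}
    (hF : ∀ n, MeasurableSet (F n)) (hfF : ∀ n x, x ∈ F n → f x ∈ F (n + 1)) (k : ℕ) :
    ∑ n ∈ Finset.range k, P.map X (F n) ≤
      ∑ r ∈ Finset.range k, P {z | r < T z} +
        ∑ n ∈ Finset.range k, P.map (fun z => f^[T z] (X z)) (F n) := by
  classical
  have hiter (t l : ℕ) (x : α) (hx : x ∈ F l) : f^[t] x ∈ F (l + t) := by
    induction t with
    | zero => exact hx
    | succ t ih => rw [iterate_succ_apply']; exact hfF _ _ ih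
  have hXT := measurable_iterate_comp hf hX hT
  have hTr (r : ℕ) : MeasurableSet {z | r < T z} := hT (measurableSet_Ioi (a := r))
  simp only [Measure.map_apply hX (hF _), Measure.map_apply hXT (hF _),
    ← lintegral_indicator_one (hX (hF _)), ← lintegral_indicator_one (hXT (hF _)),
    ← lintegral_indicator_one (hTr _)]
  rw [← lintegral_finsetSum _ fun n _ => measurable_one.indicator (hX (hF n)),
    ← lintegral_finsetSum _ fun r _ => measurable_one.indicator (hTr r),
    ← lintegral_finsetSum _ fun n _ => measurable_one.indicator (hXT (hF n)),
    ← lintegral_add_left (Finset.measurable_sum _ fun r _ => measurable_one.indicator (hTr r))]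
  refine lintegral_mono fun z => ?_
  have hz := sum_ite_le_of_shift (a := fun n => X z ∈ F n) (b := fun n => f^[T z] (X z) ∈ F n)
    (fun l => hiter (T z) l (X z)) k
  simp only [indicator_apply, Pi.one_apply, mem_preimage, mem_ofPred_eq]
  exact_mod_cast hz

end Transport

section MeasurePreserving

variable {α Z : Type*} [MeasurableSpace α] [MeasurableSpace Z] {μ : Measure α} {f : α ≃ᵐ α}
  {u v : α → ℕ}

theorem measurable_birkhoffSum {f : α → α} (hf : Measurable f) {w : α → ℕ} (hw : Measurable w)
    (n : ℕ) : Measurable (birkhoffSum f w n) :=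
  Finset.measurable_sum _ fun j _ => hw.comp (hf.iterate j)

theorem measurableSet_aheadUntil {f : α → α} (hf : Measurable f) (hu : Measurable u)
    (hv : Measurable v) (r : ℕ) : MeasurableSet (aheadUntil f u v r) := by
  simp only [aheadUntil, ofPred_forall]
  exact .iInter fun n => .iInter fun _ =>
    measurableSet_lt (measurable_birkhoffSum hf hv _) (measurable_birkhoffSum hf hu _)

theorem measurableSet_entered (f : α ≃ᵐ α) {B : ℕ → Set α} (hB : ∀ l, MeasurableSet (B l)) (n : ℕ) :
    MeasurableSet (entered f.toEquiv B n) := by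
  have hunion : entered f.toEquiv B n = ⋃ l ≤ n, f.symm^[n - l] ⁻¹' B l := by
    ext x
    simp [entered]
  rw [hunion]
  exact .iUnion fun l => .iUnion fun _ => f.symm.measurable.iterate (n - l) (hB l)

theorem sum_measure_add_sum_setLIntegral_le (hf : MeasurePreserving f μ μ) (hu : Measurable u)
    (hv : Measurable v) {B : ℕ → Set α} (hB : ∀ l, MeasurableSet (B l)) {k : ℕ}
    (hBk : ∀ l < k, B l ⊆ aheadUntil f u v (k - 1 - l)) :
    ∑ l ∈ Finset.range k, μ (B l) +
        ∑ n ∈ Finset.range k, ∫⁻ x in entered f.toEquiv B n, v x ∂μ ≤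
      ∑ n ∈ Finset.range k, ∫⁻ x in entered f.toEquiv B n, u x ∂μ := by
  classical
  have hE := measurableSet_entered f hB
  have hmeas {w : α → ℕ} (hw : Measurable w) : Measurable fun x => (w x : ℝ≥0∞) := by fun_prop
  have hiter {g : α → ℝ≥0∞} (hg : Measurable g) {C : Set α} (hC : MeasurableSet C) (n : ℕ) :
      ∫⁻ x in C, g x ∂μ = ∫⁻ x, C.indicator g (f^[n] x) ∂μ := by
    rw [← lintegral_indicator hC, (hf.iterate n).lintegral_comp (hg.indicator hC)]
  have hterm {g : α → ℝ≥0∞} (hg : Measurable g) {C : Set α} (hC : MeasurableSet C) (n : ℕ) :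
      Measurable fun x => C.indicator g (f^[n] x) :=
    (hg.indicator hC).comp (f.measurable.iterate n)
  have hsum {g : α → ℝ≥0∞} (hg : Measurable g) {C : ℕ → Set α} (hC : ∀ n, MeasurableSet (C n)) :
      ∑ n ∈ Finset.range k, ∫⁻ x in C n, g x ∂μ =
        ∫⁻ x, ∑ n ∈ Finset.range k, (C n).indicator g (f^[n] x) ∂μ := by
    rw [lintegral_finsetSum _ fun n _ => hterm hg (hC n) n]
    exact Finset.sum_congr rfl fun n _ => hiter hg (hC n) n
  simp only [← setLIntegral_one]
  rw [hsum measurable_const hB, hsum (hmeas hu) hE, hsum (hmeas hv) hE,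
    ← lintegral_add_left (Finset.measurable_sum _ fun l _ => hterm measurable_const (hB l) l)]
  refine lintegral_mono fun x => ?_
  have hx := sum_ite_iterate_le (f := f.toEquiv) (u := u) (v := v) hBk x
  simp only [indicator_apply]
  exact_mod_cast hx

theorem sum_measure_aheadUntil_le (hf : MeasurePreserving f μ μ) (hu : Measurable u)
    (hv : Measurable v) {P : Measure Z} [IsFiniteMeasure P] {X : Z → α} (hX : Measurable X)
    {T : Z → ℕ} (hT : Measurable T)
    (hPu : P.map X = μ.withDensity fun x => u x)
    (hPv : P.map (fun z => f^[T z] (X z)) = μ.withDensity fun x => v x) (k : ℕ) :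
    ∑ r ∈ Finset.range k, μ (aheadUntil f u v r) ≤ ∑ r ∈ Finset.range k, P {z | r < T z} := by
  have hA := measurableSet_aheadUntil f.measurable hu hv
  set B : ℕ → Set α := fun l => aheadUntil f u v (k - 1 - l)
  have hE := measurableSet_entered f (B := B) fun l => hA _
  have hwindow := sum_measure_add_sum_setLIntegral_le hf hu hv (B := B) (fun l => hA _)
    fun l _ => subset_rfl
  have htransport := sum_map_le_of_apply_mem f.measurable (P := P) hX hT hE
    (fun n x => apply_mem_entered (f := f.toEquiv)) k
  simp only [← withDensity_apply _ (hE _), ← hPu, ← hPv] at hwindow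
  have hfin : ∑ n ∈ Finset.range k, P.map (fun z => f^[T z] (X z)) (entered f.toEquiv B n) ≠ ∞ :=
    ENNReal.sum_ne_top.2 fun n _ => measure_ne_top _ _
  rw [← Finset.sum_range_reflect]
  exact (ENNReal.add_le_add_iff_right hfin).1 (hwindow.trans htransport)

theorem tendsto_measure_entered_const (ρ : Measure α) (f : α ≃ α) (A : Set α) :
    Tendsto (fun n => ρ (entered f (fun _ => A) n)) atTop
      (𝓝 (ρ {x | ∃ l, f.symm^[l] x ∈ A})) := by
  have hmono : Monotone (entered f fun _ => A) := fun n n' hn x hx => by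
    obtain ⟨l, hl, hxl⟩ := mem_entered_const.1 hx
    exact mem_entered_const.2 ⟨l, hl.trans hn, hxl⟩
  have hunion : {x | ∃ l, f.symm^[l] x ∈ A} = ⋃ n, entered f (fun _ => A) n := by
    ext x
    simp only [mem_ofPred_eq, mem_iUnion, mem_entered_const]
    exact ⟨fun ⟨l, hl⟩ => ⟨l, l, le_rfl, hl⟩, fun ⟨_, l, _, hl⟩ => ⟨l, hl⟩⟩
  rw [hunion]
  exact tendsto_measure_iUnion_atTop hmono

theorem eq_zero_of_mul_add_sum_le {c L : ℝ≥0∞} {a : ℕ → ℝ≥0∞} (hL : L ≠ ∞)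
    (ha : Tendsto a atTop (𝓝 L))
    (h : ∀ k : ℕ, k * c + ∑ n ∈ Finset.range k, a n ≤ k * L) : c = 0 := by
  have htop (k : ℕ) : (k : ℝ≥0∞) * L ≠ ∞ := ENNReal.mul_ne_top (ENNReal.natCast_ne_top k) hL
  have hc : c ≠ ∞ := by simpa using ne_top_of_le_ne_top (htop 1) (le_self_add.trans (h 1))
  have hatop (n : ℕ) : a n ≠ ∞ :=
    ENNReal.sum_ne_top.1 (ne_top_of_le_ne_top (htop (n + 1)) (le_add_self.trans (h (n + 1)))) n
      (Finset.self_mem_range_succ n)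
  lift L to ℝ≥0 using hL
  lift c to ℝ≥0 using hc
  lift a to ℕ → ℝ≥0 using hatop
  have hreal (k : ℕ) (hk : 0 < k) : (c : ℝ) + (k : ℝ)⁻¹ * ∑ n ∈ Finset.range k, (a n : ℝ) ≤ L := by
    have hk' : (k : ℝ) * c + ∑ n ∈ Finset.range k, (a n : ℝ) ≤ k * L := by
      have hk := h k
      beta_reduce at hk
      exact_mod_cast hk
    have hkpos : (0 : ℝ) < k := mod_cast hk
    rw [← mul_le_mul_iff_right₀ hkpos, mul_add, mul_inv_cancel_left₀ hkpos.ne']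
    exact hk'
  have hlim : (c : ℝ) + L ≤ L :=
    le_of_tendsto (tendsto_const_nhds.add
        (NNReal.tendsto_coe.2 (ENNReal.tendsto_coe.1 ha)).cesaro)
      ((eventually_gt_atTop 0).mono hreal)
  have hc0 : (c : ℝ) ≤ 0 := by linarith
  exact_mod_cast le_antisymm hc0 c.2

theorem measure_iInter_aheadUntil_eq_zero (hf : MeasurePreserving f μ μ) (hu : Measurable u)
    (hv : Measurable v)
    (huv : ∫⁻ x in {x | ∃ l, f.symm^[l] x ∈ ⋂ r, aheadUntil f u v r}, u x ∂μ =
      ∫⁻ x in {x | ∃ l, f.symm^[l] x ∈ ⋂ r, aheadUntil f u v r}, v x ∂μ)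
    (hfin : ∫⁻ x, v x ∂μ ≠ ∞) :
    μ (⋂ r, aheadUntil f u v r) = 0 := by
  set A := ⋂ r, aheadUntil f u v r
  set F := {x | ∃ l, f.symm^[l] x ∈ A}
  have hA : MeasurableSet A := .iInter fun r => measurableSet_aheadUntil f.measurable hu hv r
  have hE := measurableSet_entered f (B := fun _ => A) fun _ => hA
  have hEF (n : ℕ) : entered f.toEquiv (fun _ => A) n ⊆ F := fun x hx =>
    let ⟨l, _, hl⟩ := mem_entered_const.1 hx
    ⟨l, hl⟩
  have hlim : Tendsto (fun n => ∫⁻ x in entered f.toEquiv (fun _ => A) n, v x ∂μ) atTop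
      (𝓝 (∫⁻ x in F, v x ∂μ)) := by
    have hF : MeasurableSet F := by
      simp only [F, ofPred_exists]
      exact .iUnion fun l => f.symm.measurable.iterate l hA
    simp only [← withDensity_apply _ (hE _), ← withDensity_apply _ hF]
    exact tendsto_measure_entered_const _ f.toEquiv A
  refine eq_zero_of_mul_add_sum_le (ne_top_of_le_ne_top hfin (setLIntegral_le_lintegral F _))
    hlim fun k => ?_
  calc (k : ℝ≥0∞) * μ A + ∑ n ∈ Finset.range k, ∫⁻ x in entered f.toEquiv (fun _ => A) n, v x ∂μ
    _ ≤ ∑ n ∈ Finset.range k, ∫⁻ x in entered f.toEquiv (fun _ => A) n, u x ∂μ := by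
      have hwindow := sum_measure_add_sum_setLIntegral_le hf hu hv (B := fun _ => A) (k := k)
        (fun _ => hA) fun l _ => iInter_subset _ _
      rwa [Finset.sum_const, Finset.card_range, nsmul_eq_mul] at hwindow
    _ ≤ ∑ _n ∈ Finset.range k, ∫⁻ x in F, u x ∂μ :=
      Finset.sum_le_sum fun n _ => lintegral_mono_set (hEF n)
    _ = k * ∫⁻ x in F, v x ∂μ := by
      rw [Finset.sum_const, Finset.card_range, nsmul_eq_mul, huv]

end MeasurePreserving

section Conservative

variable {α : Type*} [MeasurableSpace α] {μ : Measure α} {f : α ≃ᵐ α}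

theorem disjoint_preimage_symm_iterate {W : Set α} (hW : ∀ x ∈ W, ∀ n ≠ 0, f^[n] x ∉ W) :
    Pairwise (Disjoint on fun n => f.symm^[n] ⁻¹' W) := by
  refine (pairwise_disjoint_on _).2 fun n n' hn => disjoint_left.2 fun x hx hx' => ?_
  refine hW _ hx' (n' - n) (Nat.sub_ne_zero_of_lt hn) ?_
  rwa [iterate_sub_apply_iterate f.apply_symm_apply hn.le]

theorem tsum_measure_inter_preimage_le (hf : MeasurePreserving f μ μ) {W C : Set α}
    (hW : MeasurableSet W) (hC : MeasurableSet C) (hwand : ∀ x ∈ W, ∀ n ≠ 0, f^[n] x ∉ W) :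
    ∑' n, μ (W ∩ f^[n] ⁻¹' C) ≤ μ C := by
  have hshift (n : ℕ) : μ (W ∩ f^[n] ⁻¹' C) = μ (f.symm^[n] ⁻¹' W ∩ C) := by
    rw [← (hf.symm.iterate n).measure_preimage
      (hW.inter (f.measurable.iterate n hC)).nullMeasurableSet, preimage_inter, ← preimage_comp,
      (RightInverse.iterate f.apply_symm_apply n).comp_eq_id, preimage_id]
  have hsymm (n : ℕ) : MeasurableSet (f.symm^[n] ⁻¹' W ∩ C) :=
    (f.symm.measurable.iterate n hW).inter hC
  simp_rw [hshift]
  rw [← measure_iUnion (fun _ _ hn =>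
    (disjoint_preimage_symm_iterate hwand hn).mono inter_subset_left inter_subset_left) hsymm]
  exact measure_mono (iUnion_subset fun n => inter_subset_right)

/-- Maharam's criterion. -/
theorem conservative_of_ae_frequently_mem {ι : Type*} [Countable ι] (hf : MeasurePreserving f μ μ)
    {C : ι → Set α} (hC : ∀ j, MeasurableSet (C j)) (hCuniv : ⋃ j, C j = univ)
    (hCfin : ∀ j, μ (C j) ≠ ∞)
    (hret : ∀ j, ∀ᵐ x ∂μ, x ∈ C j → ∃ᶠ n in atTop, f^[n] x ∈ C j) : Conservative f μ := by
  refine ⟨hf.quasiMeasurePreserving, fun B hB hB0 => ?_⟩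
  by_contra! hwand
  refine hB0 ?_
  rw [← inter_univ B, ← hCuniv, inter_iUnion]
  refine measure_iUnion_null fun j => ?_
  have hsum : ∑' n, μ ((B ∩ C j) ∩ f^[n] ⁻¹' C j) ≠ ∞ :=
    ne_top_of_le_ne_top (hCfin j) <| tsum_measure_inter_preimage_le hf (hB.inter (hC j))
      (hC j) fun x hx n hn hx' => hwand x hx.1 n hn hx'.1
  rw [measure_eq_zero_iff_ae_notMem]
  filter_upwards [ae_eventually_notMem hsum, hret j] with x hfin hret hx
  obtain ⟨n, hn, hn'⟩ := ((hret hx.2).and_eventually hfin).exists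
  exact hn' ⟨hx, hn⟩

theorem conservative_symm (hf : MeasurePreserving f μ μ) (hcons : Conservative f μ) :
    Conservative f.symm μ := by
  refine ⟨hf.symm.quasiMeasurePreserving, fun s hs hs0 => ?_⟩
  obtain ⟨x, hx, n, hn, hxn⟩ := hcons.exists_mem_iterate_mem' hs hs0
  exact ⟨f^[n] x, hxn, n, hn, (LeftInverse.iterate f.symm_apply_apply n x).symm ▸ hx⟩

theorem ae_frequently_mem_of_exists_symm (hf : MeasurePreserving f μ μ) (hcons : Conservative f μ)
    {A : Set α} (hA : MeasurableSet A) :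
    ∀ᵐ x ∂μ, (∃ l, f.symm^[l] x ∈ A) → ∃ᶠ n in atTop, f^[n] x ∈ A := by
  have hall : ∀ᵐ x ∂μ, ∀ l, f.symm^[l] x ∈ A → ∃ᶠ n in atTop, f^[n] (f.symm^[l] x) ∈ A :=
    ae_all_iff.2 fun l => (hf.symm.iterate l).quasiMeasurePreserving.ae
      (hcons.ae_mem_imp_frequently_image_mem hA.nullMeasurableSet)
  filter_upwards [hall] with x hx ⟨l, hl⟩
  have hret := hx l hl
  rw [← map_add_atTop_eq_nat l, frequently_map] at hret
  refine hret.mono fun n hn => ?_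
  rwa [iterate_add_apply, RightInverse.iterate f.apply_symm_apply l x] at hn

theorem exists_symm_ae_eq_frequently (hf : MeasurePreserving f μ μ) (hcons : Conservative f μ)
    {A : Set α} (hA : MeasurableSet A) :
    {x | ∃ l, f.symm^[l] x ∈ A} =ᵐ[μ] {x | ∃ᶠ n in atTop, f^[n] x ∈ A} := by
  filter_upwards [ae_frequently_mem_of_exists_symm hf hcons hA,
    ae_frequently_mem_of_exists_symm hf.symm (conservative_symm hf hcons) hA] with x h h'
  exact propext ⟨h, fun hx => (h' hx.exists).exists⟩

end Conservative

section ChainLaw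

variable {S : Type*}

/-- The one-sided trajectories that agree with `y` up to and including time `n`. -/
def pathCylinder (n : ℕ) (y : ℕ → S) : Set (ℕ → S) := {x | ∀ k ≤ n, x k = y k}

/-- The trajectory that starts in `i` and continues with `x`. -/
def consPath (i : S) (x : ℕ → S) : ℕ → S
  | 0 => i
  | n + 1 => x n

/-- The trajectory from time `1` on, that is, the shift of one-sided trajectories. -/
def tail (x : ℕ → S) : ℕ → S := fun n => x (n + 1)

theorem tail_iterate_apply (x : ℕ → S) (n r : ℕ) : tail^[n] x r = x (r + n) := by
  induction n generalizing x with
  | zero => rfl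
  | succ n ih => rw [iterate_succ_apply, ih]; rfl

theorem pathCylinder_eq_preimage (n : ℕ) (y : ℕ → S) :
    pathCylinder n y = Preorder.frestrictLe (π := fun _ => S) n ⁻¹'
      {Preorder.frestrictLe (π := fun _ => S) n y} := by
  ext x
  simp [pathCylinder, funext_iff]

theorem pathCylinder_zero (y : ℕ → S) : pathCylinder 0 y = {x | x 0 = y 0} := by
  ext x
  simp [pathCylinder]

theorem pathCylinder_succ (n : ℕ) (y : ℕ → S) :
    pathCylinder (n + 1) y = pathCylinder n y ∩ {x | x (n + 1) = y (n + 1)} := by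
  ext x
  simp only [pathCylinder, mem_ofPred_eq, mem_inter_iff, Nat.le_succ_iff, or_imp, forall_and,
    forall_eq]

theorem consPath_preimage_pathCylinder_succ {i : S} {y : ℕ → S} (hy : y 0 = i) (n : ℕ) :
    consPath i ⁻¹' pathCylinder (n + 1) y = pathCylinder n (tail y) := by
  ext x
  constructor
  · exact fun hx k hk => hx (k + 1) (Nat.succ_le_succ hk)
  · rintro hx (_ | k) hk
    · exact hy.symm
    · exact hx k (Nat.le_of_succ_le_succ hk)

variable [MeasurableSpace S]

@[fun_prop] theorem measurable_tail : Measurable (tail : (ℕ → S) → ℕ → S) :=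
  measurable_pi_iff.2 fun n => measurable_pi_apply (n + 1)

@[fun_prop] theorem measurable_consPath (i : S) : Measurable (consPath i) := by
  refine measurable_pi_iff.2 fun n => ?_
  cases n with
  | zero => exact measurable_const
  | succ n => exact measurable_pi_apply n

variable [DiscreteMeasurableSpace S]

theorem measurableSet_coord_eq {ι : Type*} (n : ι) (j : S) : MeasurableSet {x : ι → S | x n = j} :=
  (measurable_pi_apply n : Measurable fun x : ι → S => x n) (MeasurableSet.of_discrete (s := {j}))

theorem ae_chainLaw_zero (p : S → PMF S) (i : S) : ∀ᵐ x ∂chainLaw p i, x 0 = i := by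
  have hmarginal := Kernel.traj_map_frestrictLe_apply (X := fun _ => S)
    (κ := fun n => (stepKernel p).comap (fun x => x ⟨n, Finset.mem_Iic.2 le_rfl⟩)
      (measurable_pi_apply _)) 0 0 (fun _ => i)
  rw [Kernel.partialTraj_self, Kernel.id_apply] at hmarginal
  have hdirac : ∀ᵐ z ∂(chainLaw p i).map (Preorder.frestrictLe (π := fun _ => S) 0),
      z ⟨0, Finset.mem_Iic.2 le_rfl⟩ = i := by
    rw [chainLaw, hmarginal, ae_dirac_iff (measurableSet_coord_eq _ _)]
  exact ae_of_ae_map (by fun_prop) hdirac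

theorem chainLaw_map_frestrictLe_prod (p : S → PMF S) (i : S) (n : ℕ) :
    (chainLaw p i).map
        (fun x => (Preorder.frestrictLe (π := fun _ => S) n x, x (n + 1))) =
      ((chainLaw p i).map (Preorder.frestrictLe (π := fun _ => S) n)) ⊗ₘ
        ((stepKernel p).comap (fun x : (Finset.Iic n → S) => x ⟨n, Finset.mem_Iic.2 le_rfl⟩)
          (measurable_pi_apply _)) := by
  unfold chainLaw
  rw [Kernel.traj_map_frestrictLe_apply]
  exact (Kernel.partialTraj_compProd_eq_map_traj (X := fun _ => S) (Nat.zero_le n)).symm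

theorem chainLaw_pathCylinder_of_ne (p : S → PMF S) {i : S} {y : ℕ → S} (hy : y 0 ≠ i) (n : ℕ) :
    chainLaw p i (pathCylinder n y) = 0 :=
  measure_eq_zero_iff_ae_notMem.2 <| (ae_chainLaw_zero p i).mono fun _ hx hxy =>
    hy ((hxy 0 (Nat.zero_le n)).symm.trans hx)

variable [Countable S]

theorem measurableSet_pathCylinder (n : ℕ) (y : ℕ → S) : MeasurableSet (pathCylinder n y) := by
  rw [pathCylinder_eq_preimage]
  exact (by fun_prop : Measurable (Preorder.frestrictLe (π := fun _ => S) n)) .of_discrete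

theorem chainLaw_pathCylinder_succ (p : S → PMF S) (i : S) (n : ℕ) (y : ℕ → S) :
    chainLaw p i (pathCylinder (n + 1) y) =
      chainLaw p i (pathCylinder n y) * p (y n) (y (n + 1)) := by
  have hprod : pathCylinder (n + 1) y =
      (fun x => (Preorder.frestrictLe (π := fun _ => S) n x, x (n + 1))) ⁻¹'
        ({Preorder.frestrictLe (π := fun _ => S) n y} ×ˢ {y (n + 1)}) := by
    rw [pathCylinder_succ, pathCylinder_eq_preimage]
    rfl
  rw [hprod, ← Measure.map_apply (by fun_prop) .of_discrete, chainLaw_map_frestrictLe_prod,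
    Measure.compProd_apply_prod .of_discrete .of_discrete, Measure.restrict_singleton,
    lintegral_smul_measure, lintegral_dirac, Measure.map_apply (by fun_prop) .of_discrete,
    ← pathCylinder_eq_preimage, Kernel.comap_apply, smul_eq_mul]
  exact congrArg _ (PMF.toMeasure_apply_singleton _ _ .of_discrete)

theorem chainLaw_pathCylinder (p : S → PMF S) {i : S} {y : ℕ → S} (hy : y 0 = i) (n : ℕ) :
    chainLaw p i (pathCylinder n y) = ∏ k ∈ Finset.range n, p (y k) (y (k + 1)) := by
  induction n with
  | zero =>
    rw [pathCylinder_zero, hy, Finset.prod_range_zero]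
    exact (prob_compl_eq_zero_iff (measurableSet_coord_eq 0 i)).1 (ae_chainLaw_zero p i)
  | succ n ih => rw [chainLaw_pathCylinder_succ, ih, Finset.prod_range_succ]

theorem measure_ext_of_pathCylinder {μ ν : Measure (ℕ → S)} [IsFiniteMeasure μ]
    [IsFiniteMeasure ν] (h : ∀ n y, μ (pathCylinder n y) = ν (pathCylinder n y)) : μ = ν := by
  have hmarginal (n : ℕ) : μ.map (Preorder.frestrictLe (π := fun _ => S) n) =
      ν.map (Preorder.frestrictLe (π := fun _ => S) n) := by
    refine Measure.ext_of_singleton fun a => ?_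
    obtain ⟨y, rfl⟩ : ∃ y, Preorder.frestrictLe (π := fun _ => S) n y = a :=
      ⟨fun k => a ⟨min k n, Finset.mem_Iic.2 (min_le_right k n)⟩, by
        ext k
        simp [Finset.mem_Iic.1 k.2]⟩
    rw [Measure.map_apply (by fun_prop) .of_discrete, Measure.map_apply (by fun_prop) .of_discrete,
      ← pathCylinder_eq_preimage, h]
  have hν : IsProjectiveLimit ν (fun I : Finset ℕ => ν.map (I.restrict (π := fun _ => S))) :=
    fun _ => rfl
  refine IsProjectiveLimit.unique (fun I => ?_) hν
  have hrestrict : I.restrict (π := fun _ => S) =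
      Finset.restrict₂ (π := fun _ => S) I.subset_Iic_sup_id ∘
        Preorder.frestrictLe (π := fun _ => S) _ := rfl
  rw [hrestrict, ← Measure.map_map (by fun_prop) (by fun_prop), hmarginal,
    Measure.map_map (by fun_prop) (by fun_prop)]

theorem chainLaw_eq_sum (p : S → PMF S) (i : S) :
    chainLaw p i = Measure.sum fun j => p i j • (chainLaw p j).map (consPath i) := by
  have hprob (j : S) : IsProbabilityMeasure ((chainLaw p j).map (consPath i)) :=
    Measure.isProbabilityMeasure_map (measurable_consPath i).aemeasurable
  have : IsProbabilityMeasure (Measure.sum fun j => p i j • (chainLaw p j).map (consPath i)) :=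
    ⟨by simp [PMF.tsum_coe]⟩
  refine measure_ext_of_pathCylinder fun n y => ?_
  rw [Measure.sum_apply _ (measurableSet_pathCylinder n y)]
  simp only [Measure.smul_apply, smul_eq_mul,
    Measure.map_apply (measurable_consPath i) (measurableSet_pathCylinder n y)]
  by_cases hy : y 0 = i
  · cases n with
    | zero =>
      have huniv : consPath i ⁻¹' pathCylinder 0 y = univ := by
        rw [pathCylinder_zero, hy]
        exact eq_univ_of_forall fun _ => rfl
      simp [huniv, chainLaw_pathCylinder p hy, PMF.tsum_coe]
    | succ n =>
      simp only [consPath_preimage_pathCylinder_succ hy]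
      rw [tsum_eq_single (tail y 0) fun j hj => by
          rw [chainLaw_pathCylinder_of_ne p hj.symm, mul_zero],
        chainLaw_pathCylinder p hy, chainLaw_pathCylinder p rfl, Finset.prod_range_succ', mul_comm,
        hy]
      rfl
  · have hempty : consPath i ⁻¹' pathCylinder n y = ∅ :=
      eq_empty_of_forall_notMem fun x hx => hy (hx 0 (Nat.zero_le n)).symm
    simp [hempty, chainLaw_pathCylinder_of_ne p hy]

theorem chainLaw_apply_eq_tsum (p : S → PMF S) (i : S) {C : Set (ℕ → S)} (hC : MeasurableSet C) :
    chainLaw p i C = ∑' j, p i j * chainLaw p j (consPath i ⁻¹' C) := by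
  conv_lhs => rw [chainLaw_eq_sum, Measure.sum_apply _ hC]
  simp only [Measure.smul_apply, smul_eq_mul, Measure.map_apply (measurable_consPath i) hC]

/-- The Markov property, with the past up to time `n` encoded by `DependsOn`. -/
theorem chainLaw_inter_preimage_tail_iterate (p : S → PMF S) {n : ℕ} {k : S} {C : Set (ℕ → S)}
    (hC : MeasurableSet C) (j : S) {D : Set (ℕ → S)} (hD : MeasurableSet D)
    (hDn : DependsOn (· ∈ D) (Iic n)) (hDk : ∀ x ∈ D, x n = k) :
    chainLaw p j (D ∩ tail^[n] ⁻¹' C) = chainLaw p j D * chainLaw p k C := by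
  induction n generalizing j D with
  | zero =>
    have hconst : ∀ᵐ x ∂chainLaw p j, (x ∈ D ↔ (fun _ => j) ∈ D) := by
      filter_upwards [ae_chainLaw_zero p j] with x hx
      refine iff_of_eq (hDn fun r hr => ?_)
      rw [Nat.le_zero.1 hr, hx]
    by_cases hj : (fun _ => j) ∈ D
    · have hDuniv : D =ᵐ[chainLaw p j] univ :=
        hconst.mono fun x hx => propext ⟨fun _ => trivial, fun _ => hx.2 hj⟩
      rw [measure_congr (ae_eq_set_inter hDuniv (ae_eq_refl (tail^[0] ⁻¹' C))),
        measure_congr hDuniv, ← hDk _ hj, univ_inter, measure_univ, one_mul]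
      rfl
    · have hDzero : chainLaw p j D = 0 :=
        measure_eq_zero_iff_ae_notMem.2 (hconst.mono fun x hx hxD => hj (hx.1 hxD))
      rw [hDzero, zero_mul]
      exact measure_mono_null inter_subset_left hDzero
  | succ n ih =>
    have hCn : MeasurableSet (tail^[n + 1] ⁻¹' C) := measurable_tail.iterate (n + 1) hC
    rw [chainLaw_apply_eq_tsum p j (hD.inter hCn), chainLaw_apply_eq_tsum p j hD,
      ← ENNReal.tsum_mul_right]
    refine tsum_congr fun l => ?_
    have hpast : DependsOn (· ∈ consPath j ⁻¹' D) (Iic n) := fun x y hxy => hDn fun r hr => by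
      cases r with
      | zero => rfl
      | succ r => exact hxy r (Nat.le_of_succ_le_succ hr)
    rw [mul_assoc, ← ih l (measurable_consPath j hD) hpast fun x hx => hDk _ hx]
    rfl

theorem chainLaw_coord_eq_inter (p : S → PMF S) {C : Set (ℕ → S)} (hC : MeasurableSet C) (j k : S)
    (n : ℕ) : chainLaw p j ({x | x n = k} ∩ tail^[n] ⁻¹' C) =
      chainLaw p j {x | x n = k} * chainLaw p k C := by
  refine chainLaw_inter_preimage_tail_iterate p hC j (measurableSet_coord_eq n k)
    (fun x y hxy => ?_) fun x hx => hx
  simp only [mem_ofPred_eq, hxy n self_mem_Iic]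

variable {p : S → PMF S}

theorem IsRecurrent.ae_frequently (hrec : IsRecurrent p) (i : S) :
    ∀ᵐ x ∂chainLaw p i, ∃ᶠ n in atTop, x n = i := by
  have hmeas : MeasurableSet {x : ℕ → S | ∃ n, 0 < n ∧ x n = i} := by
    simp only [ofPred_exists, ofPred_and]
    exact .iUnion fun n => .inter (.const _) (measurableSet_coord_eq n i)
  have hreturn : ∀ᵐ x ∂chainLaw p i, ∀ n, x n = i → ∃ r, 0 < r ∧ x (r + n) = i := by
    refine ae_all_iff.2 fun n => ?_
    have hlast := chainLaw_coord_eq_inter p hmeas.compl i i n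
    rw [show chainLaw p i {x | ∃ n, 0 < n ∧ x n = i}ᶜ = 0 from hrec i, mul_zero,
      measure_eq_zero_iff_ae_notMem] at hlast
    filter_upwards [hlast] with x hx hxn
    by_contra! hno
    refine hx ⟨hxn, fun ⟨r, hr, hxr⟩ => hno r hr ?_⟩
    rwa [tail_iterate_apply] at hxr
  filter_upwards [hreturn, ae_chainLaw_zero p i] with x hx h0
  refine frequently_atTop.2 fun N => ?_
  induction N with
  | zero => exact ⟨0, le_rfl, h0⟩
  | succ N ih =>
    obtain ⟨n, hn, hxn⟩ := ih
    obtain ⟨r, hr, hxr⟩ := hx n hxn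
    exact ⟨r + n, by omega, hxr⟩

theorem IsRecurrent.ae_exists_eq (hrec : IsRecurrent p) (hirr : IsIrreducible p) (i j : S) :
    ∀ᵐ x ∂chainLaw p j, ∃ n, x n = i := by
  obtain ⟨n, hn⟩ := hirr i j
  have hmeas : MeasurableSet {x : ℕ → S | ∃ n, x n = i} := by
    simp only [ofPred_exists]
    exact .iUnion fun n => measurableSet_coord_eq n i
  have hnever : chainLaw p i ({x | x n = j} ∩ tail^[n] ⁻¹' {x | ∃ n, x n = i}ᶜ) = 0 := by
    refine measure_eq_zero_iff_ae_notMem.2 ((hrec.ae_frequently i).mono fun x hx hxn => hxn.2 ?_)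
    obtain ⟨r, hr, hxr⟩ := frequently_atTop.1 hx n
    refine ⟨r - n, ?_⟩
    rwa [tail_iterate_apply, Nat.sub_add_cancel hr]
  rw [chainLaw_coord_eq_inter p hmeas.compl] at hnever
  exact (mul_eq_zero.1 hnever).resolve_left hn.ne'

theorem chainLaw_eq_of_preimage_tail_eq (hrec : IsRecurrent p) (hirr : IsIrreducible p)
    {C : Set (ℕ → S)} (hC : MeasurableSet C) (hinv : tail ⁻¹' C = C) (i j : S) :
    chainLaw p j C = chainLaw p i C := by
  -- On `D n` the first visit to `i` is at time `n`, and there the chain starts afresh.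
  set D : ℕ → Set (ℕ → S) := disjointed fun n => {x | x n = i}
  have hDi (n : ℕ) : D n ⊆ {x | x n = i} := disjointed_subset _ n
  have hDm (n : ℕ) : MeasurableSet (D n) :=
    MeasurableSet.disjointed (fun n => measurableSet_coord_eq n i) n
  have hDn (n : ℕ) : DependsOn (· ∈ D n) (Iic n) := fun x y hxy => by
    simp only [D, disjointed_eq_inter_compl, mem_inter_iff, mem_iInter, mem_compl_iff,
      mem_ofPred_eq, hxy n self_mem_Iic]
    exact congrArg _ (propext (forall₂_congr fun r hr => by rw [hxy r hr.le]))
  have hcover : ∀ᵐ x ∂chainLaw p j, x ∈ ⋃ n, D n := by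
    rw [iUnion_disjointed]
    exact (hrec.ae_exists_eq hirr i j).mono fun x hx => mem_iUnion.2 hx
  have hrestart (n : ℕ) : chainLaw p j (C ∩ D n) = chainLaw p j (D n) * chainLaw p i C := by
    rw [← chainLaw_inter_preimage_tail_iterate p hC j (hDm n) (hDn n) (hDi n), inter_comm,
      IsFixedPt.preimage_iterate hinv n]
  calc chainLaw p j C
    _ = chainLaw p j (C ∩ ⋃ n, D n) :=
      (measure_inter_conull hcover).symm
    _ = (∑' n, chainLaw p j (D n)) * chainLaw p i C := by
      rw [inter_iUnion, measure_iUnion (fun a b hab => ((disjoint_disjointed _ hab).mono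
        inter_subset_right inter_subset_right)) fun n => hC.inter (hDm n), ← ENNReal.tsum_mul_right]
      exact tsum_congr hrestart
    _ = chainLaw p i C := by
      rw [← measure_iUnion (disjoint_disjointed _) hDm,
        (prob_compl_eq_zero_iff (.iUnion hDm)).1 hcover, one_mul]

end ChainLaw

section Shift

variable {S : Type*}

/-- The left shift of two-sided trajectories. -/
def shift [MeasurableSpace S] : (ℤ → S) ≃ᵐ (ℤ → S) where
  toFun ω n := ω (n + 1)
  invFun ω n := ω (n - 1)
  left_inv ω := funext fun n => congrArg ω (sub_add_cancel n 1)
  right_inv ω := funext fun n => congrArg ω (add_sub_cancel_right n 1)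
  measurable_toFun := measurable_pi_iff.2 fun n => measurable_pi_apply (n + 1)
  measurable_invFun := measurable_pi_iff.2 fun n => measurable_pi_apply (n - 1)

/-- The part of a two-sided trajectory from time `0` on. -/
def forward (ω : ℤ → S) : ℕ → S := fun n => ω n

theorem forward_glue (x : (ℕ → S) × (ℕ → S)) : forward (glue x) = x.1 := by
  ext n
  simp [forward, glue]

variable [MeasurableSpace S]

theorem shift_apply (ω : ℤ → S) (n : ℤ) : shift ω n = ω (n + 1) := rfl

theorem shift_iterate_apply (ω : ℤ → S) (t : ℕ) (n : ℤ) : shift^[t] ω n = ω (n + t) := by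
  induction t generalizing ω with
  | zero => simp
  | succ t ih => rw [iterate_succ_apply, ih, shift_apply, Nat.cast_succ, add_assoc]

theorem measurable_forward : Measurable (forward : (ℤ → S) → ℕ → S) :=
  measurable_pi_iff.2 fun n => measurable_pi_apply (n : ℤ)

theorem semiconj_forward_shift_tail : Semiconj (forward : (ℤ → S) → ℕ → S) shift tail :=
  fun _ => rfl

theorem shift_glue_consPath {i : S} (j : S) (x : ℕ → S) {y : ℕ → S} (hy : y 0 = i) :
    shift (glue (consPath i x, y)) = glue (x, consPath j y) := by
  ext n
  simp only [shift_apply, glue]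
  rcases lt_trichotomy n (-1) with h | rfl | h
  · obtain ⟨k, rfl⟩ : ∃ k : ℕ, n = -(k + 2 : ℕ) := ⟨(-n - 2).toNat, by omega⟩
    rw [if_neg (by omega), if_neg (by omega), show (-(-((k + 2 : ℕ) : ℤ))).toNat = k + 2 by omega,
      show (-(-((k + 2 : ℕ) : ℤ) + 1)).toNat = k + 1 by omega]
    rfl
  · simpa using! hy.symm
  · obtain ⟨k, rfl⟩ : ∃ k : ℕ, n = k := ⟨n.toNat, by omega⟩
    rw [if_pos (by omega), if_pos (by omega), show ((k : ℤ) + 1).toNat = k + 1 by omega]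
    rfl

end Shift

section StationaryLaw

variable {S : Type*} {p : S → PMF S} {m : S → ℝ≥0} (hm : IsStationary p m)

theorem mul_dual_apply (i j : S) : (m j : ℝ≥0∞) * dual p m hm j i = m i * p i j := by
  change (m j : ℝ≥0∞) * (m i / m j * p i j) = _
  rw [← mul_assoc, ENNReal.mul_div_cancel (mod_cast (hm.pos j).ne') ENNReal.coe_ne_top]

variable [MeasurableSpace S] [DiscreteMeasurableSpace S]

/-- The law `∑ m_j P_j` of the stationary two-sided chain. Its total mass is that of `m`, which may
be infinite. -/
noncomputable def stationaryLaw : Measure (ℤ → S) :=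
  Measure.sum fun j => (m j : ℝ≥0∞) • twoSidedLaw p m hm j

theorem map_forward_twoSidedLaw (j : S) :
    (twoSidedLaw p m hm j).map forward = chainLaw p j := by
  have hfst : forward ∘ glue = (Prod.fst : (ℕ → S) × (ℕ → S) → ℕ → S) := funext forward_glue
  rw [twoSidedLaw, Measure.map_map measurable_forward measurable_glue, hfst, Measure.map_fst_prod,
    measure_univ, one_smul]

theorem ae_twoSidedLaw_forward {j : S} {P : (ℕ → S) → Prop} (h : ∀ᵐ x ∂chainLaw p j, P x) :
    ∀ᵐ ω ∂twoSidedLaw p m hm j, P (forward ω) :=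
  ae_of_ae_map measurable_forward.aemeasurable (by rwa [map_forward_twoSidedLaw])

theorem ae_twoSidedLaw_zero (j : S) : ∀ᵐ ω ∂twoSidedLaw p m hm j, ω 0 = j :=
  ae_twoSidedLaw_forward hm (ae_chainLaw_zero p j)

theorem stationaryLaw_apply_of_subset {i : S} {s : Set (ℤ → S)} (hs : MeasurableSet s)
    (hsi : s ⊆ {ω | ω 0 = i}) : stationaryLaw hm s = m i * twoSidedLaw p m hm i s := by
  simp only [stationaryLaw, Measure.sum_apply _ hs, Measure.smul_apply, smul_eq_mul]
  refine tsum_eq_single i fun j hj => ?_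
  have hnull : twoSidedLaw p m hm j s = 0 := measure_eq_zero_iff_ae_notMem.2 <|
    (ae_twoSidedLaw_zero hm j).mono fun ω hω hωs => hj (hω.symm.trans (hsi hωs))
  rw [hnull, mul_zero]

theorem absolutelyContinuous_stationaryLaw (j : S) : twoSidedLaw p m hm j ≪ stationaryLaw hm :=
  (Measure.absolutelyContinuous_smul (c := (m j : ℝ≥0∞)) (mod_cast (hm.pos j).ne')).trans
    (Measure.absolutelyContinuous_sum_right j .rfl)

theorem withDensity_stationaryLaw (w : S → ℝ≥0∞) :
    (stationaryLaw hm).withDensity (fun ω => w (ω 0)) =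
      Measure.sum fun j => (m j * w j) • twoSidedLaw p m hm j := by
  rw [stationaryLaw, withDensity_sum]
  congr 1
  ext1 j
  have hconst : (fun ω : ℤ → S => w (ω 0)) =ᵐ[twoSidedLaw p m hm j] fun _ => w j :=
    (ae_twoSidedLaw_zero hm j).mono fun ω hω => congrArg w hω
  rw [withDensity_smul_measure, withDensity_congr_ae hconst, withDensity_const, smul_smul]

theorem lintegral_comp_zero_stationaryLaw (w : S → ℝ≥0∞) :
    ∫⁻ ω, w (ω 0) ∂stationaryLaw hm = ∑' j, m j * w j := by
  rw [← setLIntegral_univ, ← withDensity_apply _ .univ, withDensity_stationaryLaw]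
  simp [Measure.sum_apply]

theorem withDensity_stationaryLaw_eq_smul {c : ℝ≥0∞} {α : PMF S} {w : S → ℝ≥0∞}
    (hw : ∀ j, c * α j = m j * w j) :
    (stationaryLaw hm).withDensity (fun ω => w (ω 0)) = c • twoSidedLawOf p m hm α := by
  refine Measure.ext fun s hs => ?_
  simp only [withDensity_stationaryLaw, twoSidedLawOf, Measure.smul_apply, Measure.sum_apply _ hs,
    smul_eq_mul, ← ENNReal.tsum_mul_left, ← mul_assoc, hw]

theorem map_shift_glue_consPath (i j : S) :
    (((chainLaw p j).map (consPath i)).prod (chainLaw (dual p m hm) i)).map (shift ∘ glue) =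
      ((chainLaw p j).prod ((chainLaw (dual p m hm) i).map (consPath j))).map glue := by
  have hfst : ((chainLaw p j).map (consPath i)).prod (chainLaw (dual p m hm) i) =
      ((chainLaw p j).prod (chainLaw (dual p m hm) i)).map (Prod.map (consPath i) id) := by
    rw [← Measure.map_prod_map _ _ (measurable_consPath i) measurable_id, Measure.map_id]
  have hsnd : (chainLaw p j).prod ((chainLaw (dual p m hm) i).map (consPath j)) =
      ((chainLaw p j).prod (chainLaw (dual p m hm) i)).map (Prod.map id (consPath j)) := by
    rw [← Measure.map_prod_map _ _ measurable_id (measurable_consPath j), Measure.map_id]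
  rw [hfst, hsnd, Measure.map_map (shift.measurable.comp measurable_glue)
      ((measurable_consPath i).prodMap measurable_id),
    Measure.map_map measurable_glue (measurable_id.prodMap (measurable_consPath j))]
  refine Measure.map_congr ?_
  filter_upwards [Measure.quasiMeasurePreserving_snd.ae (ae_chainLaw_zero (dual p m hm) i)]
    with z hz
  exact shift_glue_consPath j z.1 hz

variable [Countable S]

theorem map_shift_twoSidedLaw (i : S) :
    (twoSidedLaw p m hm i).map shift = Measure.sum fun j => p i j •
      ((chainLaw p j).prod ((chainLaw (dual p m hm) i).map (consPath j))).map glue := by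
  rw [twoSidedLaw, Measure.map_map shift.measurable measurable_glue, chainLaw_eq_sum p i,
    Measure.prod_sum_left, Measure.map_sum (shift.measurable.comp measurable_glue).aemeasurable]
  simp only [Measure.prod_smul_left, Measure.map_smul, map_shift_glue_consPath]

theorem twoSidedLaw_eq_sum (j : S) :
    twoSidedLaw p m hm j = Measure.sum fun i => dual p m hm j i •
      ((chainLaw p j).prod ((chainLaw (dual p m hm) i).map (consPath j))).map glue := by
  rw [twoSidedLaw, chainLaw_eq_sum (dual p m hm) j, Measure.prod_sum_right,
    Measure.map_sum measurable_glue.aemeasurable]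
  simp only [Measure.prod_smul_right, Measure.map_smul]

theorem measurePreserving_shift :
    MeasurePreserving shift (stationaryLaw hm) (stationaryLaw hm) := by
  refine ⟨shift.measurable, ?_⟩
  simp only [stationaryLaw, Measure.map_sum shift.measurable.aemeasurable, Measure.map_smul,
    map_shift_twoSidedLaw]
  simp only [twoSidedLaw_eq_sum hm]
  refine Measure.ext fun s hs => ?_
  simp only [Measure.sum_apply _ hs, Measure.smul_apply, smul_eq_mul, ← ENNReal.tsum_mul_left,
    ← mul_assoc, mul_dual_apply]
  exact ENNReal.tsum_comm

theorem conservative_shift (hrec : IsRecurrent p) : Conservative shift (stationaryLaw hm) := by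
  refine conservative_of_ae_frequently_mem (measurePreserving_shift hm)
    (C := fun j => {ω | ω 0 = j}) (measurableSet_coord_eq 0)
    (iUnion_eq_univ_iff.2 fun ω => ⟨ω 0, rfl⟩)
    (fun j => ?_) fun j => ?_
  · rw [stationaryLaw_apply_of_subset hm (measurableSet_coord_eq 0 j) subset_rfl]
    exact ENNReal.mul_ne_top ENNReal.coe_ne_top (measure_ne_top _ _)
  · refine Measure.ae_sum_iff.2 fun k => Measure.ae_smul_measure ?_ _
    filter_upwards [ae_twoSidedLaw_zero hm k, ae_twoSidedLaw_forward hm (hrec.ae_frequently k)]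
      with ω h0 hω hj
    obtain rfl : k = j := h0.symm.trans hj
    simpa only [mem_ofPred_eq, shift_iterate_apply, zero_add] using! hω

end StationaryLaw

section Lead

variable {S : Type*} [MeasurableSpace S] {a b : S → ℕ}

/-- The two-sided trajectories along which, at each of the times `0, …, r`, the weights `a` of the
states visited since time `0` add up to more than their weights `b`. -/
def leadUntil (a b : S → ℕ) : ℕ → Set (ℤ → S) :=
  aheadUntil shift (fun ω => a (ω 0)) fun ω => b (ω 0)

theorem birkhoffSum_tail_forward (a : S → ℕ) (n : ℕ) (ω : ℤ → S) :
    birkhoffSum tail (fun x => a (x 0)) n (forward ω) =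
      birkhoffSum shift (fun ω => a (ω 0)) n ω :=
  Finset.sum_congr rfl fun r _ => by
    rw [← (semiconj_forward_shift_tail.iterate_right r).eq]
    rfl

theorem leadUntil_eq_preimage (a b : S → ℕ) (r : ℕ) :
    leadUntil a b r = forward ⁻¹' aheadUntil tail (fun x => a (x 0)) (fun x => b (x 0)) r := by
  ext ω
  simp only [leadUntil, aheadUntil, preimage_ofPred_eq, birkhoffSum_tail_forward]

theorem apply_zero_lt_of_mem_leadUntil {r : ℕ} {ω : ℤ → S} (hω : ω ∈ leadUntil a b r) :
    b (ω 0) < a (ω 0) := by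
  simpa using hω 0 (Nat.zero_le r)

theorem leadUntil_indicator_subset {i : S} {r : ℕ} :
    leadUntil (indicator {i} 1) b r ⊆ {ω | ω 0 = i} := fun ω hω =>
  mem_of_indicator_ne_zero (a := ω 0) (Nat.ne_zero_of_lt (apply_zero_lt_of_mem_leadUntil hω))

variable [DiscreteMeasurableSpace S]

theorem measurable_comp_coord {ι : Type*} (a : S → ℕ) (n : ι) :
    Measurable fun x : ι → S => a (x n) :=
  (Measurable.of_discrete (f := a)).comp (measurable_pi_apply n)

theorem measurableSet_leadUntil (a b : S → ℕ) (r : ℕ) : MeasurableSet (leadUntil a b r) :=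
  measurableSet_aheadUntil shift.measurable (measurable_comp_coord a 0)
    (measurable_comp_coord b 0) r

theorem exists_frequently_leadUntil_eq_preimage (a b : S → ℕ) :
    ∃ C : Set (ℕ → S), MeasurableSet C ∧ tail ⁻¹' C = C ∧
      {ω | ∃ᶠ n in atTop, shift^[n] ω ∈ ⋂ r, leadUntil a b r} = forward ⁻¹' C := by
  set A : Set (ℕ → S) := ⋂ r, aheadUntil tail (fun x => a (x 0)) (fun x => b (x 0)) r
  have hA : MeasurableSet A := .iInter fun r => measurableSet_aheadUntil measurable_tail
    (measurable_comp_coord a 0) (measurable_comp_coord b 0) r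
  refine ⟨limsup (fun n => tail^[n] ⁻¹' A) atTop,
    .measurableSet_limsup fun n => measurable_tail.iterate n hA, ?_, ?_⟩
  · simpa only [preimage_iterate_eq] using!
      (CompleteLatticeHom.setPreimage tail).apply_limsup_iterate A
  · ext ω
    simp only [mem_ofPred_eq, mem_preimage, mem_limsup_iff_frequently_mem, leadUntil_eq_preimage,
      ← preimage_iInter, (semiconj_forward_shift_tail.iterate_right _).eq]
    rfl

variable {p : S → PMF S} {m : S → ℝ≥0} (hm : IsStationary p m) [Countable S]

theorem setLIntegral_preimage_forward (hirr : IsIrreducible p) (hrec : IsRecurrent p)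
    {C : Set (ℕ → S)} (hC : MeasurableSet C) (hinv : tail ⁻¹' C = C) (w : S → ℝ≥0∞) (i : S) :
    ∫⁻ ω in forward ⁻¹' C, w (ω 0) ∂stationaryLaw hm = (∑' j, m j * w j) * chainLaw p i C := by
  have hFC := measurable_forward hC
  rw [← withDensity_apply _ hFC, withDensity_stationaryLaw, Measure.sum_apply _ hFC,
    ← ENNReal.tsum_mul_right]
  refine tsum_congr fun j => ?_
  rw [Measure.smul_apply, smul_eq_mul, ← Measure.map_apply measurable_forward hC,
    map_forward_twoSidedLaw, chainLaw_eq_of_preimage_tail_eq hrec hirr hC hinv i j]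

theorem stationaryLaw_iInter_leadUntil_eq_zero (hirr : IsIrreducible p) (hrec : IsRecurrent p)
    (hab : ∑' j, (m j : ℝ≥0∞) * a j = ∑' j, (m j : ℝ≥0∞) * b j)
    (hfin : ∑' j, (m j : ℝ≥0∞) * b j ≠ ∞) :
    stationaryLaw hm (⋂ r, leadUntil a b r) = 0 := by
  obtain _ | ⟨⟨i⟩⟩ := isEmpty_or_nonempty S
  · simp [Measure.eq_zero_of_isEmpty (stationaryLaw hm)]
  obtain ⟨C, hC, hinv, hfreq⟩ := exists_frequently_leadUntil_eq_preimage a b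
  have hlead := exists_symm_ae_eq_frequently (measurePreserving_shift hm)
    (conservative_shift hm hrec) (.iInter (measurableSet_leadUntil a b))
  rw [hfreq] at hlead
  have hint (w : S → ℕ) : ∫⁻ ω in {ω | ∃ l, shift.symm^[l] ω ∈ ⋂ r, leadUntil a b r},
      (w (ω 0) : ℝ≥0∞) ∂stationaryLaw hm = (∑' j, (m j : ℝ≥0∞) * w j) * chainLaw p i C := by
    rw [setLIntegral_congr hlead]
    exact setLIntegral_preimage_forward hm hirr hrec hC hinv (fun j => w j) i
  refine measure_iInter_aheadUntil_eq_zero (measurePreserving_shift hm) (measurable_comp_coord a 0)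
    (measurable_comp_coord b 0) ?_ ?_
  · exact ((hint a).trans (congrArg (· * _) hab)).trans (hint b).symm
  · rwa [lintegral_comp_zero_stationaryLaw hm (fun j => b j)]

end Lead

theorem mul_pure_apply {S : Type*} (m : S → ℝ≥0) (i j : S) :
    (m i : ℝ≥0∞) * PMF.pure i j = m j * (indicator {i} 1 j : ℕ) := by
  obtain rfl | hj := eq_or_ne j i <;> simp [*]

section Embedding

variable {S : Type*} [MeasurableSpace S] [DiscreteMeasurableSpace S]
  {p : S → PMF S} {m : S → ℝ≥0} (hm : IsStationary p m)

theorem twoSidedLawOf_pure (i : S) :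
    twoSidedLawOf p m hm (PMF.pure i) = twoSidedLaw p m hm i := by
  refine Measure.ext fun s hs => ?_
  rw [twoSidedLawOf, Measure.sum_apply _ hs, tsum_eq_single i fun j hj => by simp [hj]]
  simp

instance (i : S) {Ω : Type*} [MeasurableSpace Ω] (Q : Kernel (ℤ → S) Ω) [IsMarkovKernel Q] :
    IsProbabilityMeasure (extendedLaw p m hm i Q) :=
  inferInstanceAs (IsProbabilityMeasure (twoSidedLaw p m hm i ⊗ₘ Q))

variable {hm} {i : S} {ν : PMF S} {b : S → ℕ} {Ω : Type*} [MeasurableSpace Ω]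
  {Q : Kernel (ℤ → S) Ω} {T : (ℤ → S) × Ω → ℕ}

theorem IsEmbedding.measurable_nat (hT : IsEmbedding p m hm i ν Q fun z => (T z : ℤ)) :
    Measurable T := by
  simpa [Function.comp_def] using! (Measurable.of_discrete (f := Int.toNat)).comp hT.measurable

variable [Countable S]

theorem IsEmbedding.sum_leadUntil_le [IsMarkovKernel Q]
    (hT : IsEmbedding p m hm i ν Q fun z => (T z : ℤ))
    (hb : ∀ j, (m i : ℝ≥0∞) * ν j = m j * b j) (k : ℕ) :
    ∑ r ∈ Finset.range k, twoSidedLaw p m hm i (leadUntil (indicator {i} 1) b r) ≤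
      ∑ r ∈ Finset.range k, extendedLaw p m hm i Q {z | r < T z} := by
  have hmi : (m i : ℝ≥0∞) ≠ 0 := mod_cast (hm.pos i).ne'
  have hstart : ((m i : ℝ≥0∞) • extendedLaw p m hm i Q).map Prod.fst =
      (stationaryLaw hm).withDensity fun ω => (indicator {i} 1 (ω 0) : ℕ) := by
    have hi := withDensity_stationaryLaw_eq_smul hm (mul_pure_apply m i)
    rw [hi, twoSidedLawOf_pure, Measure.map_smul]
    congr 1
    exact Measure.fst_compProd _ _
  have hend : ((m i : ℝ≥0∞) • extendedLaw p m hm i Q).map (fun z => shift^[T z] z.1) =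
      (stationaryLaw hm).withDensity fun ω => b (ω 0) := by
    rw [withDensity_stationaryLaw_eq_smul hm hb, Measure.map_smul, ← hT.law]
    simp only [← shift_iterate_apply]
  have := (extendedLaw p m hm i Q).smul_finite (ENNReal.coe_ne_top (r := m i))
  have hsum := sum_measure_aheadUntil_le (measurePreserving_shift hm) (measurable_comp_coord _ 0)
    (measurable_comp_coord b 0) measurable_fst hT.measurable_nat hstart hend k
  have hlead (r : ℕ) := stationaryLaw_apply_of_subset hm
    (measurableSet_leadUntil (indicator {i} 1) b r) leadUntil_indicator_subset
  change ∑ r ∈ Finset.range k, stationaryLaw hm (leadUntil (indicator {i} 1) b r) ≤ _ at hsum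
  simp only [hlead, Measure.smul_apply, smul_eq_mul, ← Finset.mul_sum] at hsum
  exact (ENNReal.mul_le_mul_iff_right hmi ENNReal.coe_ne_top).1 hsum

theorem twoSidedLaw_iInter_leadUntil_eq_zero (hirr : IsIrreducible p) (hrec : IsRecurrent p)
    (hb : ∀ j, (m i : ℝ≥0∞) * ν j = m j * b j) :
    twoSidedLaw p m hm i (⋂ r, leadUntil (indicator {i} 1) b r) = 0 := by
  have htarget : ∑' j, (m j : ℝ≥0∞) * b j = m i := by
    simp only [← hb, ENNReal.tsum_mul_left, PMF.tsum_coe, mul_one]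
  have hsource : ∑' j, (m j : ℝ≥0∞) * (indicator {i} 1 j : ℕ) = m i := by
    simp only [← mul_pure_apply, ENNReal.tsum_mul_left, PMF.tsum_coe, mul_one]
  refine absolutelyContinuous_stationaryLaw hm i <| stationaryLaw_iInter_leadUntil_eq_zero hm hirr
    hrec (hsource.trans htarget.symm) ?_
  rw [htarget]
  exact ENNReal.coe_ne_top

end Embedding

section LocalTime

variable {S : Type*} {m : S → ℝ≥0}

theorem encard_Icc_inter_coord_eq (ω : ℤ → S) (j : S) (n : ℕ) :
    ((Icc 0 (n : ℤ) ∩ {r | ω r = j}).encard : ℝ≥0∞) =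
      ∑ r ∈ Finset.range (n + 1), indicator {j} 1 (ω r) := by
  classical
  have hvisits : Icc 0 (n : ℤ) ∩ {r | ω r = j} =
      (((Finset.range (n + 1)).filter fun r : ℕ => ω r = j).map Nat.castEmbedding :
        Finset ℤ) := by
    ext r
    simp only [mem_inter_iff, mem_Icc, mem_ofPred_eq, Finset.coe_map, Nat.castEmbedding_apply,
      mem_image, Finset.mem_coe, Finset.mem_filter, Finset.mem_range]
    constructor
    · rintro ⟨⟨h0, hn⟩, hr⟩
      lift r to ℕ using h0
      exact ⟨r, ⟨by omega, hr⟩, rfl⟩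
    · rintro ⟨r, ⟨hn, hr⟩, rfl⟩
      exact ⟨⟨by omega, by omega⟩, hr⟩
  rw [hvisits, encard_coe_eq_coe_finsetCard, Finset.card_map]
  simp [indicator_apply]

theorem tsum_mul_localTime_Icc (m : S → ℝ≥0) (w : S → ℝ≥0∞) (ω : ℤ → S) (n : ℕ) :
    ∑' j, w j * localTime m ω j (Icc 0 (n : ℤ)) =
      ∑ r ∈ Finset.range (n + 1), w (ω r) / m (ω r) := by
  simp only [localTime, encard_Icc_inter_coord_eq, div_eq_mul_inv, Finset.sum_mul, Finset.mul_sum]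
  rw [Summable.tsum_finsetSum fun _ _ => ENNReal.summable]
  refine Finset.sum_congr rfl fun r _ => ?_
  rw [tsum_eq_single (ω r) fun j hj => by simp [hj.symm]]
  simp

theorem exists_natCast_mul_eq {i : S} {ν : PMF S} (hm : ∀ j, 0 < m j)
    (hν : ∀ j, ∃ k : ℤ, (m i : ℝ) / m j * (ν j).toReal = k) :
    ∃ b : S → ℕ, ∀ j, (m i : ℝ≥0∞) * ν j = m j * b j := by
  choose k hk using hν
  have hk0 (j : S) : 0 ≤ k j := by
    have hk0 : (0 : ℝ) ≤ k j := hk j ▸ by positivity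
    exact_mod_cast hk0
  lift k to S → ℕ using hk0
  refine ⟨k, fun j => ?_⟩
  have hmj : (m j : ℝ) ≠ 0 := mod_cast (hm j).ne'
  have hkj := hk j
  rw [Int.cast_natCast] at hkj
  rw [← ENNReal.toReal_eq_toReal_iff' (ENNReal.mul_ne_top ENNReal.coe_ne_top (ν.apply_ne_top j))
    (ENNReal.mul_ne_top ENNReal.coe_ne_top (ENNReal.natCast_ne_top _)), ENNReal.toReal_mul,
    ENNReal.toReal_mul, ENNReal.toReal_natCast, ← hkj, ENNReal.coe_toReal, ENNReal.coe_toReal]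
  field_simp

variable [MeasurableSpace S] {i : S} {ν : PMF S} {b : S → ℕ}

theorem mul_tsum_mul_localTime_Icc (hm : ∀ j, 0 < m j) {c : ℝ≥0∞} {w : S → ℝ≥0∞} {a : S → ℕ}
    (ha : ∀ j, c * w j = m j * a j) (ω : ℤ → S) (n : ℕ) :
    c * ∑' j, w j * localTime m ω j (Icc 0 (n : ℤ)) =
      (birkhoffSum shift (fun ω => a (ω 0)) (n + 1) ω : ℕ) := by
  rw [tsum_mul_localTime_Icc, Finset.mul_sum, birkhoffSum, Nat.cast_sum]
  refine Finset.sum_congr rfl fun r _ => ?_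
  rw [shift_iterate_apply, zero_add, ← mul_div_assoc, ha, mul_comm,
    ENNReal.mul_div_cancel_right (mod_cast (hm _).ne') ENNReal.coe_ne_top]

theorem localTime_le_iff (hm : ∀ j, 0 < m j) (hb : ∀ j, (m i : ℝ≥0∞) * ν j = m j * b j)
    (ω : ℤ → S) (n : ℕ) :
    localTime m ω i (Icc 0 (n : ℤ)) ≤ ∑' j, ν j * localTime m ω j (Icc 0 (n : ℤ)) ↔
      birkhoffSum shift (fun ω => indicator {i} 1 (ω 0)) (n + 1) ω ≤
        birkhoffSum shift (fun ω => b (ω 0)) (n + 1) ω := by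
  have hpure : localTime m ω i (Icc 0 (n : ℤ)) =
      ∑' j, PMF.pure i j * localTime m ω j (Icc 0 (n : ℤ)) := by
    rw [tsum_eq_single i fun j hj => by simp [hj]]
    simp
  rw [hpure, ← ENNReal.mul_le_mul_iff_right (mod_cast (hm i).ne') ENNReal.coe_ne_top,
    mul_tsum_mul_localTime_Icc hm (mul_pure_apply m i), mul_tsum_mul_localTime_Icc hm hb,
    Nat.cast_le]

theorem lt_Tstar_iff (hm : ∀ j, 0 < m j) (hb : ∀ j, (m i : ℝ≥0∞) * ν j = m j * b j)
    (ω : ℤ → S) (r : ℕ) : r < Tstar m i ν ω ↔ ω ∈ leadUntil (indicator {i} 1) b r := by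
  simp only [← ENat.add_one_le_iff (ENat.natCast_ne_top r), Tstar, le_sInf_iff, forall_mem_image,
    mem_ofPred_eq, localTime_le_iff hm hb, leadUntil, aheadUntil]
  refine forall_congr' fun n => ?_
  rw [← not_le (a := birkhoffSum _ _ _ _), ← Nat.cast_succ, Nat.cast_le, Nat.succ_le_iff,
    imp_not_comm, not_le]

theorem Tstar_eq_top_iff (hm : ∀ j, 0 < m j) (hb : ∀ j, (m i : ℝ≥0∞) * ν j = m j * b j)
    (ω : ℤ → S) : Tstar m i ν ω = ⊤ ↔ ω ∈ ⋂ r, leadUntil (indicator {i} 1) b r := by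
  simp only [mem_iInter, ← lt_Tstar_iff hm hb, ENat.eq_top_iff_forall_gt]

theorem lt_toNat_Tstar_iff (hm : ∀ j, 0 < m j) (hb : ∀ j, (m i : ℝ≥0∞) * ν j = m j * b j)
    (ω : ℤ → S) (r : ℕ) : r < (Tstar m i ν ω).toNat ↔
      ω ∈ leadUntil (indicator {i} 1) b r \ ⋂ r, leadUntil (indicator {i} 1) b r := by
  rw [Set.mem_sdiff, ← lt_Tstar_iff hm hb, ← Tstar_eq_top_iff hm hb]
  cases Tstar m i ν ω with
  | top => simp
  | coe t => simp

theorem measurable_toNat_Tstar [DiscreteMeasurableSpace S] (hm : ∀ j, 0 < m j)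
    (hb : ∀ j, (m i : ℝ≥0∞) * ν j = m j * b j) :
    Measurable fun ω : ℤ → S => (Tstar m i ν ω).toNat := by
  refine measurable_of_Ioi fun r => ?_
  have hIoi : (fun ω => (Tstar m i ν ω).toNat) ⁻¹' Ioi r =
      leadUntil (indicator {i} 1) b r \ ⋂ r, leadUntil (indicator {i} 1) b r :=
    ext fun ω => lt_toNat_Tstar_iff hm hb ω r
  rw [hIoi]
  exact (measurableSet_leadUntil _ b r).diff (.iInter (measurableSet_leadUntil _ b))

end LocalTime

end TwoSidedChain

open TwoSidedChain in
theorem theorem4 {S : Type*} [Countable S] [MeasurableSpace S] [DiscreteMeasurableSpace S]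
    (p : S → PMF S) (hirr : IsIrreducible p) (hrec : IsRecurrent p)
    (m : S → ℝ≥0) (hm : IsStationary p m)
    (i : S) (ν : PMF S) (hνi : ν i = 0)
    (hν : ∀ j, ∃ k : ℤ, (m i : ℝ) / m j * (ν j).toReal = k) :
    (∀ᵐ ω ∂(twoSidedLaw p m hm i), Tstar m i ν ω ≠ ⊤) ∧
    ∀ (Ω : Type*) [MeasurableSpace Ω] (Q : Kernel (ℤ → S) Ω) [IsMarkovKernel Q]
      (T : (ℤ → S) × Ω → ℕ), IsEmbedding p m hm i ν Q (fun z => (T z : ℤ)) →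
      ∀ ψ : ℕ → ℝ, (∀ n, 0 ≤ ψ n) → IsConcave ψ →
        ∫⁻ ω, ENNReal.ofReal (ψ (Tstar m i ν ω).toNat) ∂(twoSidedLaw p m hm i) ≤
          ∫⁻ z, ENNReal.ofReal (ψ (T z)) ∂(extendedLaw p m hm i Q) := by
  obtain ⟨b, hb⟩ := exists_natCast_mul_eq hm.pos hν
  constructor
  · filter_upwards [measure_eq_zero_iff_ae_notMem.1
      (twoSidedLaw_iInter_leadUntil_eq_zero (hm := hm) hirr hrec hb)] with ω hω
    rwa [Ne, Tstar_eq_top_iff hm.pos hb]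
  · intro Ω _ Q _ T hT ψ hψ0 hψ
    refine lintegral_ofReal_concave_le (by simp) (measurable_toNat_Tstar hm.pos hb)
      hT.measurable_nat (fun k => ?_) hψ hψ0
    calc ∑ r ∈ Finset.range k, twoSidedLaw p m hm i {ω | r < (Tstar m i ν ω).toNat}
      _ ≤ ∑ r ∈ Finset.range k, twoSidedLaw p m hm i (leadUntil (Set.indicator {i} 1) b r) :=
        Finset.sum_le_sum fun r _ => measure_mono fun ω hω =>
          ((lt_toNat_Tstar_iff hm.pos hb ω r).1 hω).1
      _ ≤ ∑ r ∈ Finset.range k, extendedLaw p m hm i Q {z | r < T z} := hT.sum_leadUntil_le hb k
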